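/- Let $U(L(sl_2))$ be the universal enveloping algebra over $\mathbb C$ of the loop algebra $\mathbb C[t,t^{-1}]\otimes sl_2$, with generators $x_k^{+}=t^k\otimes e$, $x_k^{-}=t^k\otimes f$, $h_k=t^k\otimes h$ ($k\in\mathbb Z$). These satisfy $[h_j,x_k^{\pm}]=\pm 2x_{j+k}^{\pm}$, $[x_j^+,x_k^-]=h_{j+k}$, $[h_j,h_k]=0$, $[x_j^\pm,x_k^\pm]=0$. Let $U(B)$ be the subalgebra generated by $h_0$, $x_0^+$, $x_1^-$; it contains $h_k$, $x_k^+$ for $k\ge 0$ and $x_k^-$ for $k\ge 1$. Let $V_B=U(B)\Psi$ be a finite-dimensional $U(B)$-module generated by a highest weight vector $\Psi$, i.e. $\Psi\neq 0$, $x_k^+\Psi=0$ and $h_k\Psi=d_k\Psi$ with $d_k\in\mathbb C$ for all $k\ge 0$. Suppose that $x_1^-$ is nilpotent of degree $r$ in $V_B$, i.e. $(x_1^-)^{r+1}\Psi=0$ and $(x_1^-)^j\Psi\ne 0$ for $0<j\le r$. For $k\ge 0$ let $\lambda_k$ be the eigenvalue defined by $\frac{(x_0^+)^k}{k!}\frac{(x_1^-)^k}{k!}\Psi=\lambda_k\Psi$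 (a highest weight vector is always an eigenvector of these operators), and put $P_\Psi(u)=\sum_{k=0}^r\lambda_k(-u)^k$. Suppose that $$P_\Psi(u)=\prod_{j=1}^s(1-a_ju)^{m_j}$$ with distinct evaluation parameters $a_1,\dots,a_s\in\mathbb C$ and multiplicities $m_j\ge 1$, and that the evaluation parameters are nonzero: $a_1a_2\cdots a_s\neq 0$. For a collection $A=\{\alpha_1,\dots,\alpha_m\}$ of $m$ parameters put $$x_m^-(A)=\sum_{k=0}^m(-1)^k\,x_{m-k}^-\sum_{1\le i_1<\cdots<i_k\le m}\alpha_{i_1}\cdots\alpha_{i_k};$$ if $0\in A$, the coefficient of $x_0^-$ vanishes and $x_m^-(A)\in U(B)$. Let $\boldsymbol a^{(1)}=\{a_1,\dots,a_s,0\}$. Then $V_B$ is irreducible as a $U(B)$-module if and only if $$x_{s+1}^-(\boldsymbol a^{(1)})\,\Psi=0 .$$ -/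

import Mathlib

noncomputable section

namespace LoopSL2

open scoped TensorProduct
open LieAlgebra LieAlgebra.SpecialLinear

attribute [local instance 100] LieRing.ofAssociativeRing

/-- The loop algebra `ℂ[t, t⁻¹] ⊗ sl₂(ℂ)`. -/
abbrev L : Type := loopAlgebra ℂ ℤ (sl (Fin 2) ℂ)

/-- The universal enveloping algebra `U(L(sl₂))`. -/
abbrev U : Type := UniversalEnvelopingAlgebra ℂ L

/-- The matrix `e = E₁₂` of `sl₂`. -/
def e : sl (Fin 2) ℂ := single 0 1 (by decide) 1

/-- The matrix `f = E₂₁` of `sl₂`. -/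
def f : sl (Fin 2) ℂ := single 1 0 (by decide) 1

/-- The matrix `h = E₁₁ - E₂₂` of `sl₂`. -/
def h : sl (Fin 2) ℂ := singleSubSingle 0 1 1

/-- The image in `U(L(sl₂))` of the loop `t ^ k ⊗ y`. -/
def gen (k : ℤ) (y : sl (Fin 2) ℂ) : U :=
  UniversalEnvelopingAlgebra.ι ℂ ((AddMonoidAlgebra.single k (1 : ℂ)) ⊗ₜ[ℂ] y : L)

/-- The generator `x_k^+`, for `k ∈ ℤ`. -/
def xPlus (k : ℤ) : U := gen k e

/-- The generator `x_k^-`, for `k ∈ ℤ`. -/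
def xMinus (k : ℤ) : U := gen k f

/-- The generator `h_k`, for `k ∈ ℤ`. -/
def hGen (k : ℤ) : U := gen k h

lemma lie_e_f : ⁅e, f⁆ = h := by
  ext i j
  fin_cases i <;> fin_cases j <;>
    simp [e, f, h, LieRing.of_associative_ring_bracket]

lemma lie_h_e : ⁅h, e⁆ = (2 : ℂ) • e := by
  ext i j
  fin_cases i <;> fin_cases j <;>
    simp [e, h, LieRing.of_associative_ring_bracket, Matrix.mul_apply, Matrix.single_apply] <;> norm_num

lemma lie_h_f : ⁅h, f⁆ = (-2 : ℂ) • f := by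
  ext i j
  fin_cases i <;> fin_cases j <;>
    simp [f, h, LieRing.of_associative_ring_bracket, Matrix.mul_apply, Matrix.single_apply] <;> norm_num

lemma gen_commutator (j k : ℤ) (y z : sl (Fin 2) ℂ) :
    gen j y * gen k z - gen k z * gen j y = gen (j + k) ⁅y, z⁆ := by
  unfold gen
  rw [← LieRing.of_associative_ring_bracket, ← LieHom.map_lie,
    LieAlgebra.ExtendScalars.bracket_tmul, AddMonoidAlgebra.single_mul_single, mul_one]

lemma gen_smul (k : ℤ) (c : ℂ) (y : sl (Fin 2) ℂ) : gen k (c • y) = c • gen k y := by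
  unfold gen
  rw [TensorProduct.tmul_smul, map_smul]

/-- The defining relation `[x_j^+, x_k^-] = h_{j+k}`. -/
lemma xPlus_xMinus (j k : ℤ) :
    xPlus j * xMinus k - xMinus k * xPlus j = hGen (j + k) := by
  simp only [xPlus, xMinus, hGen, gen_commutator, lie_e_f]

/-- The defining relation `[h_j, x_k^+] = 2 x_{j+k}^+`. -/
lemma hGen_xPlus (j k : ℤ) :
    hGen j * xPlus k - xPlus k * hGen j = (2 : ℂ) • xPlus (j + k) := by
  simp only [xPlus, hGen, gen_commutator, lie_h_e, gen_smul]

/-- The defining relation `[h_j, x_k^-] = -2 x_{j+k}^-`. -/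
lemma hGen_xMinus (j k : ℤ) :
    hGen j * xMinus k - xMinus k * hGen j = (-2 : ℂ) • xMinus (j + k) := by
  simp only [xMinus, hGen, gen_commutator, lie_h_f, gen_smul]

/-- The Borel subalgebra `U(B)` of `U(L(sl₂))`: the unital associative subalgebra generated by
`h_0`, `x_0^+` and `x_1^-`. -/
def UB : Subalgebra ℂ U := Algebra.adjoin ℂ {hGen 0, xPlus 0, xMinus 1}

lemma hGen_zero_mem : hGen 0 ∈ UB := Algebra.subset_adjoin (by simp)

lemma xPlus_zero_mem : xPlus 0 ∈ UB := Algebra.subset_adjoin (by simp)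

lemma xMinus_one_mem : xMinus 1 ∈ UB := Algebra.subset_adjoin (by simp)

lemma hGen_one_mem : hGen 1 ∈ UB := by
  have := xPlus_xMinus 0 1
  rw [zero_add] at this
  rw [← this]
  exact UB.sub_mem (UB.mul_mem xPlus_zero_mem xMinus_one_mem)
    (UB.mul_mem xMinus_one_mem xPlus_zero_mem)

lemma xPlus_mem (k : ℕ) : xPlus k ∈ UB := by
  induction k with
  | zero => simpa using xPlus_zero_mem
  | succ k ih =>
    have h1 : xPlus ((k + 1 : ℕ) : ℤ)
        = (2 : ℂ)⁻¹ • (hGen 1 * xPlus k - xPlus k * hGen 1) := by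
      rw [hGen_xPlus, smul_smul, inv_mul_cancel₀ two_ne_zero, one_smul]
      congr 1
      push_cast
      ring
    rw [h1]
    exact UB.smul_mem (UB.sub_mem (UB.mul_mem hGen_one_mem ih) (UB.mul_mem ih hGen_one_mem)) _

lemma xMinus_mem (k : ℕ) (hk : 0 < k) : xMinus k ∈ UB := by
  induction k, hk using Nat.le_induction with
  | base => simpa using xMinus_one_mem
  | succ k _ ih =>
    have h1 : xMinus ((k + 1 : ℕ) : ℤ)
        = (-2 : ℂ)⁻¹ • (hGen 1 * xMinus k - xMinus k * hGen 1) := by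
      rw [hGen_xMinus, smul_smul, inv_mul_cancel₀ (by norm_num), one_smul]
      congr 1
      push_cast
      ring
    rw [h1]
    exact UB.smul_mem (UB.sub_mem (UB.mul_mem hGen_one_mem ih) (UB.mul_mem ih hGen_one_mem)) _

lemma hGen_mem (k : ℕ) : hGen k ∈ UB := by
  rcases k with _ | k
  · simpa using hGen_zero_mem
  · have h1 := xPlus_xMinus k 1
    push_cast
    rw [← h1]
    exact UB.sub_mem (UB.mul_mem (xPlus_mem k) xMinus_one_mem)
      (UB.mul_mem xMinus_one_mem (xPlus_mem k))

/-- `x_k^+ ∈ U(B)` for `k ≥ 0`. -/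
def xP (k : ℕ) : UB := ⟨xPlus k, xPlus_mem k⟩

/-- `h_k ∈ U(B)` for `k ≥ 0`. -/
def hB (k : ℕ) : UB := ⟨hGen k, hGen_mem k⟩

/-- `xMsucc k` is `x_{k+1}^- ∈ U(B)`, for `k ≥ 0`. -/
def xMsucc (k : ℕ) : UB := ⟨xMinus (k + 1 : ℕ), xMinus_mem (k + 1) k.succ_pos⟩

/-- The generator with parameters
`x_m^-(A) = ∑_{k=0}^m (-1)^k e_k(A) x_{m-k}^-`, where `A` is a collection of `m` parameters
(with multiplicity) and `e_k` is the elementary symmetric polynomial. -/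
def xMinusParam (A : Multiset ℂ) : U :=
  ∑ k ∈ Finset.range (A.card + 1), ((-1 : ℂ) ^ k * A.esymm k) • xMinus ((A.card : ℤ) - k)

lemma xMinusParam_mem (A : Multiset ℂ) (hA : (0 : ℂ) ∈ A) : xMinusParam A ∈ UB := by
  unfold xMinusParam
  refine UB.sum_mem fun k hk => ?_
  rcases Nat.lt_or_ge k A.card with hlt | hge
  · have h1 : ((A.card : ℤ) - k) = ((A.card - k : ℕ) : ℤ) := by omega
    rw [h1]
    exact UB.smul_mem (xMinus_mem _ (by omega)) _
  · have h1 : k = A.card := by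
      have := Finset.mem_range.mp hk
      omega
    have h2 : A.esymm k = 0 := by
      rw [h1, Multiset.esymm, Multiset.powersetCard_self]
      simpa using Multiset.prod_eq_zero hA
    rw [h2]
    simp

/-- For a collection `a` of `s` parameters, the element `x_{s+1}^-(a^{(1)})` of `U(B)`, where
`a^{(1)} = a ∪ {0}`. -/
def xMinusExt (a : Multiset ℂ) : UB :=
  ⟨xMinusParam (0 ::ₘ a), xMinusParam_mem _ (Multiset.mem_cons_self 0 a)⟩

section Modules

variable {V : Type*} [AddCommGroup V] [Module ℂ V] [Module UB V] [IsScalarTower ℂ UB V]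

/-- `Ψ` is a highest weight vector of `U(B)` with highest weight `(d_k)_{k ≥ 0}`. -/
structure IsHighestWeightVector (d : ℕ → ℂ) (Ψ : V) : Prop where
  ne_zero : Ψ ≠ 0
  xP_smul : ∀ k : ℕ, xP k • Ψ = 0
  hB_smul : ∀ k : ℕ, hB k • Ψ = d k • Ψ

/-- `x_1^-` is nilpotent of degree `r` (on the module generated by `Ψ`). -/
def IsNilpotentOfDegree (r : ℕ) (Ψ : V) : Prop :=
  (xMsucc 0) ^ (r + 1) • Ψ = 0 ∧ ∀ j : ℕ, 0 < j → j ≤ r → (xMsucc 0) ^ j • Ψ ≠ 0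

/-- The operator `(x_0^+)^{(k)} (x_1^-)^{(k)}`, with divided powers `X^{(k)} = X^k / k!`. -/
def dividedProduct (k : ℕ) : UB :=
  ((k.factorial : ℂ)⁻¹ • xP 0 ^ k) * ((k.factorial : ℂ)⁻¹ • xMsucc 0 ^ k)

open Classical in
/-- The eigenvalue `λ_k` of `(x_0^+)^{(k)} (x_1^-)^{(k)}` on `Ψ`. It exists for every highest
weight vector, see `dividedProduct_smul`, and is unique since `Ψ ≠ 0`. -/
def eigenvalue (k : ℕ) (Ψ : V) : ℂ :=
  if hc : ∃ c : ℂ, dividedProduct k • Ψ = c • Ψ then hc.choose else 0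

/-- The span of the vectors `x_{j_1}^- ⋯ x_{j_n}^- Ψ`. -/
def sector (Ψ : V) : ℕ → Submodule ℂ V
  | 0 => Submodule.span ℂ {Ψ}
  | n + 1 => Submodule.span ℂ {w | ∃ k : ℕ, ∃ v ∈ sector Ψ n, w = xMsucc k • v}

lemma hB_mem_sector {d : ℕ → ℂ} {Ψ : V} (hΨ : IsHighestWeightVector d Ψ) (n j : ℕ) {v : V}
    (hv : v ∈ sector Ψ n) : hB j • v ∈ sector Ψ n := by
  induction n generalizing j v with
  | zero =>
    obtain ⟨c, rfl⟩ := Submodule.mem_span_singleton.mp hv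
    rw [smul_algebra_smul_comm, hΨ.hB_smul]
    exact Submodule.smul_mem _ _ (Submodule.smul_mem _ _ (Submodule.mem_span_singleton_self Ψ))
  | succ n ih =>
    refine Submodule.span_induction ?_ ?_ ?_ ?_ hv
    · rintro w ⟨k, v, hv, rfl⟩
      have hc : hB j * xMsucc k = xMsucc k * hB j + (-2 : ℂ) • xMsucc (j + k) := by
        apply Subtype.ext
        have h1 := hGen_xMinus j (k + 1 : ℕ)
        have h2 : ((j + k + 1 : ℕ) : ℤ) = (j : ℤ) + (k + 1 : ℕ) := by push_cast; ring
        change hGen j * xMinus (k + 1 : ℕ) =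
          xMinus (k + 1 : ℕ) * hGen j + (-2 : ℂ) • xMinus (j + k + 1 : ℕ)
        rw [h2, ← h1]
        abel
      rw [← mul_smul, hc, add_smul, mul_smul, smul_assoc]
      exact Submodule.add_mem _ (Submodule.subset_span ⟨k, _, ih j hv, rfl⟩)
        (Submodule.smul_mem _ _ (Submodule.subset_span ⟨j + k, v, hv, rfl⟩))
    · rw [smul_zero]
      exact Submodule.zero_mem _
    · intro x y _ _ hx hy
      rw [smul_add]
      exact Submodule.add_mem _ hx hy
    · intro c x _ hx
      rw [smul_algebra_smul_comm]
      exact Submodule.smul_mem _ _ hx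

lemma xP_mem_sector {d : ℕ → ℂ} {Ψ : V} (hΨ : IsHighestWeightVector d Ψ) (n j : ℕ) {v : V}
    (hv : v ∈ sector Ψ (n + 1)) : xP j • v ∈ sector Ψ n := by
  have hc : ∀ k, xP j * xMsucc k = xMsucc k * xP j + hB (j + k + 1) := fun k => by
    apply Subtype.ext
    have h1 := xPlus_xMinus j (k + 1 : ℕ)
    have h2 : ((j + k + 1 : ℕ) : ℤ) = (j : ℤ) + (k + 1 : ℕ) := by push_cast; ring
    change xPlus j * xMinus (k + 1 : ℕ) = xMinus (k + 1 : ℕ) * xPlus j + hGen (j + k + 1 : ℕ)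
    rw [h2, ← h1]
    abel
  induction n generalizing v with
  | zero =>
    refine Submodule.span_induction ?_ ?_ ?_ ?_ hv
    · rintro w ⟨k, v, hv, rfl⟩
      rw [← mul_smul, hc, add_smul, mul_smul]
      have h0 : xP j • v = 0 := by
        obtain ⟨c, rfl⟩ := Submodule.mem_span_singleton.mp hv
        rw [smul_algebra_smul_comm, hΨ.xP_smul, smul_zero]
      rw [h0, smul_zero, zero_add]
      exact hB_mem_sector hΨ 0 _ hv
    · rw [smul_zero]
      exact Submodule.zero_mem _
    · intro x y _ _ hx hy
      rw [smul_add]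
      exact Submodule.add_mem _ hx hy
    · intro c x _ hx
      rw [smul_algebra_smul_comm]
      exact Submodule.smul_mem _ _ hx
  | succ n ih =>
    refine Submodule.span_induction ?_ ?_ ?_ ?_ hv
    · rintro w ⟨k, v, hv, rfl⟩
      rw [← mul_smul, hc, add_smul, mul_smul]
      exact Submodule.add_mem _ (Submodule.subset_span ⟨k, _, ih hv, rfl⟩)
        (hB_mem_sector hΨ _ _ hv)
    · rw [smul_zero]
      exact Submodule.zero_mem _
    · intro x y _ _ hx hy
      rw [smul_add]
      exact Submodule.add_mem _ hx hy
    · intro c x _ hx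
      rw [smul_algebra_smul_comm]
      exact Submodule.smul_mem _ _ hx

/-- A highest weight vector is an eigenvector of every `(x_0^+)^{(k)} (x_1^-)^{(k)}`, and
`eigenvalue k Ψ` is the eigenvalue. -/
lemma dividedProduct_smul {d : ℕ → ℂ} {Ψ : V} (hΨ : IsHighestWeightVector d Ψ) (k : ℕ) :
    dividedProduct k • Ψ = eigenvalue k Ψ • Ψ := by
  have hx : ∀ n, (xMsucc 0) ^ n • Ψ ∈ sector Ψ n := fun n => by
    induction n with
    | zero =>
      rw [pow_zero, one_smul]
      exact Submodule.mem_span_singleton_self Ψ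
    | succ n ih =>
      rw [pow_succ', mul_smul]
      exact Submodule.subset_span ⟨0, _, ih, rfl⟩
  have hy : ∀ n, ∀ v ∈ sector Ψ n, (xP 0) ^ n • v ∈ sector Ψ 0 := fun n => by
    induction n with
    | zero =>
      intro v hv
      rwa [pow_zero, one_smul]
    | succ n ih =>
      intro v hv
      rw [pow_succ, mul_smul]
      exact ih _ (xP_mem_sector hΨ n 0 hv)
  obtain ⟨c, hc⟩ := Submodule.mem_span_singleton.mp (hy k _ (hx k))
  have hex : ∃ c : ℂ, dividedProduct k • Ψ = c • Ψ := by
    refine ⟨(k.factorial : ℂ)⁻¹ * ((k.factorial : ℂ)⁻¹ * c), ?_⟩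
    rw [dividedProduct, mul_smul, smul_assoc, smul_assoc, smul_algebra_smul_comm, ← hc,
      smul_smul, smul_smul, mul_assoc]
  rw [eigenvalue, dif_pos hex]
  exact hex.choose_spec

/-- The generalized Drinfeld polynomial `P_Ψ(u) = ∑_{k=0}^r λ_k (-u)^k`. -/
def drinfeldPoly (r : ℕ) (Ψ : V) : Polynomial ℂ :=
  ∑ k ∈ Finset.range (r + 1), Polynomial.C (eigenvalue k Ψ) * (-Polynomial.X) ^ k

/-- `a_1, …, a_s` are the evaluation parameters of `Ψ`, with multiplicities `m_1, …, m_s`: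
they are distinct, the multiplicities are positive, and
`P_Ψ(u) = ∏_{j=1}^s (1 - a_j u)^{m_j}`. -/
structure IsEvaluationParameters (r : ℕ) (Ψ : V) {s : ℕ} (a : Fin s → ℂ) (m : Fin s → ℕ) :
    Prop where
  distinct : Function.Injective a
  mult_pos : ∀ j, 0 < m j
  factorization : drinfeldPoly r Ψ =
    ∏ j, (1 - Polynomial.C (a j) * Polynomial.X) ^ m j

end Modules

end LoopSL2

end

/-!
For a polynomial `p`, write `x^-(p)` for the current linear in `p` with `x^-(t ^ k) = x_k^-`, and
put `q = ∏ (t - a_j)`, so that the condition of the theorem is `x^-(t q) Ψ = 0`.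

By Garland's identity (`raise_pow_mul_lower_pow`), `P_Ψ(u)` is the solution of
`P' = -(∑ d_{k+1} u ^ k) P` with `P(0) = 1`. Comparing with the logarithmic derivative of
`∏ (1 - a_j u) ^ m_j` gives `d_{k+1} = ∑ m_j a_j ^ (k + 1)`. Hence `x_k^+` sends `x^-(t q) Ψ` to
`(∑ m_j a_j ^ (k + 1) q(a_j)) Ψ = 0`: this vector is singular of weight `d_0 - 2`, so it vanishes
if `V` is simple.

Conversely, if `x^-(t q) Ψ = 0`, then also `[h(p), x^-(t q)] Ψ = 0` for all `p`, so `x^-(t p)` acts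
on `V` through the values `p(a_j)`. As no `a_j` is zero, the currents localise to one copy of `sl₂`
for every node, whose Casimir element commutes with all `x_k^-` and therefore acts on `V` by the
scalar by which it acts on `Ψ`. A singular vector thus has the same weight as `Ψ` and is a multiple
of it, whereas every nonzero submodule of `V` contains a nonzero singular vector.
-/

noncomputable section

namespace LoopSL2

open Module
open Finset.HasAntidiagonal (antidiagonal mem_antidiagonal)

section LogarithmicDerivative

lemma derivation_prod_eq_sum_mul {R A ι : Type*} [CommSemiring R] [CommSemiring A] [Algebra R A]
    (D : Derivation R A A) {f g : ι → A} (h : ∀ i, D (f i) = g i * f i) (S : Finset ι) :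
    D (∏ i ∈ S, f i) = (∑ i ∈ S, g i) * ∏ i ∈ S, f i := by
  classical
  induction S using Finset.induction_on with
  | empty => simp
  | insert i S hi ih =>
    rw [Finset.prod_insert hi, Finset.sum_insert hi, D.leibniz, ih, h, smul_eq_mul, smul_eq_mul]
    ring

open PowerSeries

variable {R : Type*} [CommRing R]

lemma mk_pow_mul_one_sub (c : R) : (mk fun k => c ^ k) * (1 - C c * X) = 1 := by
  have := congrArg (rescale c) (mk_one_mul_one_sub_eq_one R)
  simpa only [map_mul, map_sub, map_one, rescale_mk, rescale_X, Pi.one_apply, mul_one] using this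

lemma derivative_one_sub_pow (c : R) (m : ℕ) :
    derivative R ((1 - C c * X) ^ m) = -(mk fun k => m * c ^ (k + 1)) * (1 - C c * X) ^ m := by
  have h_linear : derivative R (1 - C c * X) = -(C c * mk fun k => c ^ k) * (1 - C c * X) := by
    rw [neg_mul, mul_assoc, mk_pow_mul_one_sub, ← smul_eq_C_mul]
    simp [smul_eq_C_mul]
  have h_sum : (mk fun k => (m : R) * c ^ (k + 1)) = m • (C c * mk fun k => c ^ k) := by
    ext k
    rw [map_nsmul, coeff_C_mul, coeff_mk, coeff_mk, nsmul_eq_mul, pow_succ']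
  have h_pow := derivation_prod_eq_sum_mul (derivative R) (fun _ : ℕ => h_linear) (Finset.range m)
  rw [Finset.prod_const, Finset.sum_const, Finset.card_range] at h_pow
  rw [h_pow, h_sum, smul_neg]

lemma eq_sum_pow_of_derivative_eq {ι : Type*} [Fintype ι] [IsDomain R] {d : ℕ → R} {a : ι → R}
    {m : ι → ℕ}
    (h : derivative R (∏ i, (1 - C (a i) * X) ^ m i) = -mk d * ∏ i, (1 - C (a i) * X) ^ m i)
    (k : ℕ) : d k = ∑ i, m i * a i ^ (k + 1) := by
  have h_prod : (∏ i, (1 - C (a i) * X) ^ m i : PowerSeries R) ≠ 0 := by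
    refine Finset.prod_ne_zero_iff.mpr fun i _ => pow_ne_zero _ (right_ne_zero_of_mul_eq_one
      (mk_pow_mul_one_sub (a i)))
  rw [derivation_prod_eq_sum_mul _ fun i => derivative_one_sub_pow (a i) (m i)] at h
  simpa using (congrArg (coeff k) (mul_right_cancel₀ h_prod h)).symm

end LogarithmicDerivative

section Garland

/-- The formal derivative of a power series over a possibly noncommutative ring, to which
`PowerSeries.derivative` does not apply. -/
def formalDeriv {R : Type*} [Semiring R] (A : PowerSeries R) : PowerSeries R :=
  PowerSeries.mk fun n => (n + 1) • PowerSeries.coeff (n + 1) A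

section Semiring

variable {R : Type*} [Semiring R]

lemma coeff_formalDeriv (A : PowerSeries R) (n : ℕ) :
    PowerSeries.coeff n (formalDeriv A) = (n + 1) • PowerSeries.coeff (n + 1) A :=
  PowerSeries.coeff_mk _ _

lemma formalDeriv_mul (A B : PowerSeries R) :
    formalDeriv (A * B) = formalDeriv A * B + A * formalDeriv B := by
  ext n
  have h_split : ∑ q ∈ antidiagonal (n + 1),
      (n + 1) • (PowerSeries.coeff q.1 A * PowerSeries.coeff q.2 B) =
      ∑ q ∈ antidiagonal (n + 1),
        q.1 • (PowerSeries.coeff q.1 A * PowerSeries.coeff q.2 B) +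
      ∑ q ∈ antidiagonal (n + 1),
        q.2 • (PowerSeries.coeff q.1 A * PowerSeries.coeff q.2 B) := by
    rw [← Finset.sum_add_distrib]
    refine Finset.sum_congr rfl fun q hq => ?_
    rw [← add_smul, mem_antidiagonal.mp hq]
  rw [coeff_formalDeriv, map_add, PowerSeries.coeff_mul, PowerSeries.coeff_mul,
    PowerSeries.coeff_mul, Finset.smul_sum, h_split, Finset.Nat.sum_antidiagonal_succ,
    Finset.Nat.sum_antidiagonal_succ' (n := n)]
  simp only [coeff_formalDeriv, zero_smul, zero_add, smul_mul_assoc, mul_smul_comm]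

lemma formalDeriv_pow {A : PowerSeries R} (hA : Commute A (formalDeriv A)) (n : ℕ) :
    formalDeriv (A ^ n) = n • (A ^ (n - 1) * formalDeriv A) := by
  induction n with
  | zero =>
    ext n
    simp [coeff_formalDeriv, PowerSeries.coeff_one]
  | succ n ih =>
    rcases n with _ | n
    · simp
    rw [pow_succ', formalDeriv_mul, ih, mul_smul_comm, ← mul_assoc, Nat.add_sub_cancel,
      Nat.add_sub_cancel, ← pow_succ', ← (hA.pow_left (n + 1)).eq, succ_nsmul' _ (n + 1)]

end Semiring

lemma raise_mul_pow_succ {R : Type*} [Ring R] {e y η y' : R}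
    (h_raise : e * y = y * e + η) (h_cartan : η * y = y * η - 2 • y') (h_comm : Commute y y')
    (n : ℕ) :
    e * y ^ (n + 1) =
      y ^ (n + 1) * e + (n + 1) • (y ^ n * η) - ((n + 1) * n) • (y ^ (n - 1) * y') := by
  induction n with
  | zero => simp [h_raise]
  | succ n ih =>
    have h_low : ((n + 1) * n) • (y ^ (n - 1) * y' * y) = ((n + 1) * n) • (y ^ n * y') := by
      rcases n with _ | n
      · simp
      rw [mul_assoc, ← h_comm.eq, ← mul_assoc, Nat.add_sub_cancel, ← pow_succ]
    rw [pow_succ, ← mul_assoc, ih, sub_mul, add_mul, mul_assoc _ e, h_raise, smul_mul_assoc,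
      mul_assoc _ η, h_cartan, smul_mul_assoc, h_low, mul_add, mul_sub, ← mul_assoc, ← mul_assoc,
      ← pow_succ, ← pow_succ, mul_smul_comm, Nat.add_sub_cancel]
    module

variable {K V : Type*} [Field K] [AddCommGroup V] [Module K V]

/-- The left ideal of the power series of operators all of whose coefficients kill `Ψ`. -/
def seriesAnnihilator (Ψ : V) : Ideal (PowerSeries (End K V)) where
  carrier := {A | ∀ n, PowerSeries.coeff n A Ψ = 0}
  zero_mem' n := by simp
  add_mem' hA hB n := by rw [map_add, LinearMap.add_apply, hA, hB, add_zero]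
  smul_mem' C A hA n := by
    rw [smul_eq_mul, PowerSeries.coeff_mul, LinearMap.sum_apply]
    exact Finset.sum_eq_zero fun q _ => by rw [End.mul_apply, hA, map_zero]

/-- The relations satisfied on a highest weight vector `Ψ` by the operators `e = x_0^+`,
`y k = x_{k+1}^-` and `η k = h_{k+1}`, the latter having the eigenvalues `δ k`. -/
structure IsCurrentAction (e : End K V) (y η : ℕ → End K V) (δ : ℕ → K) (Ψ : V) : Prop where
  comm : ∀ i j, Commute (y i) (y j)
  raise_lower : ∀ i, e * y i = y i * e + η i
  cartan_lower : ∀ i j, η i * y j = y j * η i - 2 • y (i + j + 1)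
  raise_vec : e Ψ = 0
  cartan_vec : ∀ i, η i Ψ = δ i • Ψ

namespace IsCurrentAction

variable {e : End K V} {y η : ℕ → End K V} {δ : ℕ → K} {Ψ : V}

lemma C_mul_mk (A : IsCurrentAction e y η δ Ψ) :
    PowerSeries.C e * PowerSeries.mk y =
      PowerSeries.mk y * PowerSeries.C e + PowerSeries.mk η := by
  ext1 n
  simp [PowerSeries.coeff_C_mul, PowerSeries.coeff_mul_C, A.raise_lower]

lemma mk_mul_mk (A : IsCurrentAction e y η δ Ψ) :
    PowerSeries.mk η * PowerSeries.mk y =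
      PowerSeries.mk y * PowerSeries.mk η - 2 • formalDeriv (PowerSeries.mk y) := by
  ext1 n
  have h_const : ∑ q ∈ antidiagonal n, y (q.2 + q.1 + 1) = (n + 1) • y (n + 1) := by
    rw [← Finset.Nat.card_antidiagonal n, ← Finset.sum_const]
    exact Finset.sum_congr rfl fun q hq => by
      rw [add_comm q.2, mem_antidiagonal.mp hq, Finset.Nat.card_antidiagonal]
  rw [map_sub, map_nsmul, coeff_formalDeriv, PowerSeries.coeff_mul, PowerSeries.coeff_mul,
    ← Finset.Nat.sum_antidiagonal_swap]
  simp only [PowerSeries.coeff_mk, Prod.fst_swap, Prod.snd_swap, A.cartan_lower,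
    Finset.sum_sub_distrib, ← Finset.smul_sum, h_const]

lemma commute_formalDeriv (A : IsCurrentAction e y η δ Ψ) :
    Commute (PowerSeries.mk y) (formalDeriv (PowerSeries.mk y)) := by
  ext1 n
  rw [PowerSeries.coeff_mul, PowerSeries.coeff_mul, ← Finset.Nat.sum_antidiagonal_swap]
  refine Finset.sum_congr rfl fun q _ => ?_
  simp only [coeff_formalDeriv, PowerSeries.coeff_mk, Prod.fst_swap, Prod.snd_swap,
    mul_smul_comm, smul_mul_assoc, (A.comm q.2 _).eq]

lemma raise_mul_map_mem (A : IsCurrentAction e y η δ Ψ) (p : PowerSeries K) :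
    PowerSeries.C e * p.map (algebraMap K (End K V)) ∈ seriesAnnihilator Ψ := fun n => by
  simp [PowerSeries.coeff_C_mul, A.raise_vec]

variable {p : PowerSeries K}

lemma cartan_mul_map_mem (A : IsCurrentAction e y η δ Ψ)
    (hp : PowerSeries.derivative K p = -PowerSeries.mk δ * p) :
    PowerSeries.mk η * p.map (algebraMap K (End K V)) +
      formalDeriv (p.map (algebraMap K (End K V))) ∈ seriesAnnihilator Ψ := fun n => by
  have h_coeff := congrArg (PowerSeries.coeff n) hp
  rw [PowerSeries.coeff_derivative, neg_mul, map_neg, PowerSeries.coeff_mul] at h_coeff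
  rw [map_add, coeff_formalDeriv, PowerSeries.coeff_mul]
  simp only [PowerSeries.coeff_mk, PowerSeries.coeff_map, LinearMap.add_apply,
    LinearMap.sum_apply, End.mul_apply, Module.algebraMap_end_apply, LinearMap.smul_apply,
    map_smul, A.cartan_vec, ← Nat.cast_smul_eq_nsmul K, smul_smul, ← Finset.sum_smul, ← add_smul]
  simp only [PowerSeries.coeff_mk] at h_coeff
  rw [Nat.cast_succ, mul_comm _ (PowerSeries.coeff _ p), h_coeff]
  simp [mul_comm]

/-- This is where the equation `p' = -δ p` is used: it turns the Cartan part of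
`[x_0^+, x^-(u)^(l+1)]` into a derivative. -/
lemma raise_mul_pow_mul_map_mem (A : IsCurrentAction e y η δ Ψ)
    (hp : PowerSeries.derivative K p = -PowerSeries.mk δ * p) (l : ℕ) :
    PowerSeries.C e * (PowerSeries.mk y ^ (l + 1) * p.map (algebraMap K (End K V))) +
      (l + 1) • formalDeriv (PowerSeries.mk y ^ l * p.map (algebraMap K (End K V))) ∈
        seriesAnnihilator Ψ := by
  convert (seriesAnnihilator Ψ).add_mem
    ((seriesAnnihilator Ψ).mul_mem_left (PowerSeries.mk y ^ (l + 1)) (A.raise_mul_map_mem p))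
    (Submodule.smul_of_tower_mem _ (l + 1) ((seriesAnnihilator Ψ).mul_mem_left
      (PowerSeries.mk y ^ l) (A.cartan_mul_map_mem hp))) using 1
  rw [← mul_assoc, raise_mul_pow_succ A.C_mul_mk A.mk_mul_mk A.commute_formalDeriv,
    formalDeriv_mul, formalDeriv_pow A.commute_formalDeriv]
  simp only [sub_mul, add_mul, mul_add, smul_mul_assoc, mul_assoc]
  module

theorem raise_pow_mul_lower_pow [CharZero K] (A : IsCurrentAction e y η δ Ψ)
    (hp : PowerSeries.derivative K p = -PowerSeries.mk δ * p)
    (hp0 : PowerSeries.constantCoeff p = 1) (n l : ℕ) :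
    (l.factorial : K) • (e ^ n * y 0 ^ (n + l)) Ψ =
      ((n + l).factorial * n.factorial * (-1) ^ n : K) •
        PowerSeries.coeff n (PowerSeries.mk y ^ l * p.map (algebraMap K (End K V))) Ψ := by
  induction n generalizing l with
  | zero =>
    rw [PowerSeries.coeff_zero_eq_constantCoeff, map_mul, map_pow]
    simp [hp0, ← PowerSeries.coeff_zero_eq_constantCoeff_apply]
  | succ n ih =>
    have h_ih := congrArg e (ih (l + 1))
    have h_raise := A.raise_mul_pow_mul_map_mem hp l n
    rw [map_add, LinearMap.add_apply, PowerSeries.coeff_C_mul, End.mul_apply,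
      map_nsmul, coeff_formalDeriv] at h_raise
    rw [map_smul, map_smul, eq_neg_of_add_eq_zero_left h_raise, ← End.mul_apply, ← mul_assoc,
      ← pow_succ', ← add_assoc, Nat.add_right_comm n l 1, Nat.factorial_succ l] at h_ih
    push_cast at h_ih
    refine smul_right_injective V (Nat.cast_add_one_ne_zero l : (l : K) + 1 ≠ 0) ?_
    simp only [smul_smul, h_ih, LinearMap.smul_apply, ← Nat.cast_smul_eq_nsmul K,
      Nat.factorial_succ n]
    push_cast
    module

lemma raise_pow_mul_lower_pow_self [CharZero K] (A : IsCurrentAction e y η δ Ψ)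
    (hp : PowerSeries.derivative K p = -PowerSeries.mk δ * p)
    (hp0 : PowerSeries.constantCoeff p = 1) (n : ℕ) :
    (e ^ n * y 0 ^ n) Ψ =
      (n.factorial * n.factorial * ((-1) ^ n * PowerSeries.coeff n p) : K) • Ψ := by
  simpa [smul_smul, mul_assoc] using A.raise_pow_mul_lower_pow hp hp0 n 0

end IsCurrentAction

/-- The coefficients of the solution of `p' = -(∑ δ_k u ^ k) p` with constant coefficient `1`. -/
def expCoeff (δ : ℕ → K) : ℕ → K
  | 0 => 1
  | n + 1 => -((n : K) + 1)⁻¹ * ∑ i : Fin (n + 1), δ (n - i) * expCoeff δ i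

lemma derivative_mk_expCoeff [CharZero K] (δ : ℕ → K) :
    PowerSeries.derivative K (PowerSeries.mk (expCoeff δ)) =
      -PowerSeries.mk δ * PowerSeries.mk (expCoeff δ) := by
  ext n
  have hn : (n : K) + 1 ≠ 0 := Nat.cast_add_one_ne_zero n
  rw [PowerSeries.coeff_derivative, neg_mul, map_neg, PowerSeries.coeff_mul,
    PowerSeries.coeff_mk, expCoeff, ← Finset.Nat.sum_antidiagonal_swap,
    Finset.Nat.sum_antidiagonal_eq_sum_range_succ_mk,
    Fin.sum_univ_eq_sum_range (fun i => δ (n - i) * expCoeff δ i) (n + 1)]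
  simp only [Prod.fst_swap, Prod.snd_swap, PowerSeries.coeff_mk]
  field_simp

end Garland

open Polynomial
open scoped Submodule

section PolyMap

variable {R M : Type*} [CommSemiring R] [AddCommMonoid M] [Module R M]

/-- The linear map `∑ c_k X ^ k ↦ ∑ c_k g_k`. -/
def polyMap (g : ℕ → M) : R[X] →ₗ[R] M :=
  Polynomial.lsum fun k => LinearMap.toSpanSingleton R M (g k)

lemma polyMap_monomial (g : ℕ → M) (k : ℕ) (c : R) : polyMap g (monomial k c) = c • g k := by
  simp [polyMap, Polynomial.lsum_apply, Polynomial.sum_monomial_index]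

@[simp] lemma polyMap_X_pow (g : ℕ → M) (k : ℕ) : polyMap g (X ^ k : R[X]) = g k := by
  rw [← monomial_one_right_eq_X_pow, polyMap_monomial, one_smul]

lemma eq_polyMap {T : R[X] →ₗ[R] M} {g : ℕ → M} (h : ∀ k, T (X ^ k) = g k) :
    T = polyMap g := by
  refine Polynomial.lhom_ext' fun k => LinearMap.ext_ring ?_
  rw [LinearMap.comp_apply, LinearMap.comp_apply, monomial_one_right_eq_X_pow, h, polyMap_X_pow]

lemma polyMap_zero (p : R[X]) : polyMap (fun _ => (0 : M)) p = 0 :=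
  congr($(eq_polyMap (T := 0) fun _ => rfl) p).symm

lemma map_polyMap {N : Type*} [AddCommMonoid N] [Module R N] (T : M →ₗ[R] N) (g : ℕ → M)
    (p : R[X]) : T (polyMap g p) = polyMap (fun k => T (g k)) p :=
  congr($(eq_polyMap (T := T ∘ₗ polyMap g) (by simp)) p)

lemma polyMap_succ (g : ℕ → M) (p : R[X]) : polyMap (fun k => g (k + 1)) p = polyMap g (X * p) :=
  congr($(eq_polyMap (T := polyMap g ∘ₗ LinearMap.mulLeft R X) (by simp [← pow_succ'])) p).symm

lemma polyMap_mul_polyMap {A : Type*} [Semiring A] [Algebra R A] {f g k : ℕ → A}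
    (h : ∀ i j, f i * g j = g j * f i + k (i + j)) (p q : R[X]) :
    polyMap f p * polyMap g q = polyMap g q * polyMap f p + polyMap k (p * q) := by
  induction p using Polynomial.induction_on' with
  | add p p' hp hp' =>
    simp only [map_add, add_mul, mul_add, hp, hp']
    abel
  | monomial i b =>
    induction q using Polynomial.induction_on' with
    | add q q' hq hq' =>
      simp only [map_add, add_mul, mul_add, hq, hq']
      abel
    | monomial j c =>
      rw [monomial_mul_monomial, polyMap_monomial, polyMap_monomial, polyMap_monomial,
        smul_mul_smul_comm, h, smul_add, smul_mul_smul_comm, mul_comm c b]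

lemma polyMap_X_mul_eq_sum_eval {ι : Type*} [Fintype ι] {g : ℕ → R} {a b : ι → R}
    (hg : ∀ k, g (k + 1) = ∑ i, b i * a i ^ (k + 1)) (p : R[X]) :
    polyMap g (X * p) = ∑ i, b i * (X * p).eval (a i) := by
  have h_sum := eq_polyMap (T := ∑ i, b i • (leval (a i) ∘ₗ LinearMap.mulLeft R X))
    (g := fun k => g (k + 1)) fun k => by simp [hg, ← pow_succ']
  rw [← polyMap_succ, ← h_sum]
  simp

lemma prod_X_sub_C_dvd {F ι : Type*} [Field F] [Fintype ι] {a : ι → F}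
    (ha : Function.Injective a) {p : F[X]} (hp : ∀ i, p.eval (a i) = 0) :
    (∏ i, (X - C (a i))) ∣ p :=
  Finset.prod_dvd_of_coprime (fun _ _ _ _ hij => pairwise_coprime_X_sub_C ha hij)
    fun i _ => dvd_iff_isRoot.mpr (hp i)

end PolyMap

section Currents

lemma gen_mul_comm (j k : ℤ) (y : LieAlgebra.SpecialLinear.sl (Fin 2) ℂ) :
    gen j y * gen k y = gen k y * gen j y := by
  rw [← sub_eq_zero, gen_commutator, lie_self]
  simpa using gen_smul (j + k) 0 0

lemma xP_mul_xMsucc (j k : ℕ) : xP j * xMsucc k = xMsucc k * xP j + hB (j + k + 1) := by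
  refine Subtype.ext (sub_eq_iff_eq_add'.mp ?_)
  simpa [xP, xMsucc, hB, add_assoc] using xPlus_xMinus j (k + 1 : ℕ)

lemma hB_mul_xMsucc (j k : ℕ) :
    hB j * xMsucc k = xMsucc k * hB j + (-2 : ℂ) • xMsucc (j + k) := by
  refine Subtype.ext (sub_eq_iff_eq_add'.mp ?_)
  simpa [xMsucc, hB, add_assoc] using hGen_xMinus j (k + 1 : ℕ)

lemma hB_mul_xP (j k : ℕ) : hB j * xP k = xP k * hB j + (2 : ℂ) • xP (j + k) := by
  refine Subtype.ext (sub_eq_iff_eq_add'.mp ?_)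
  simpa [xP, hB] using hGen_xPlus j k

lemma commute_xMsucc (j k : ℕ) : Commute (xMsucc j) (xMsucc k) :=
  Subtype.ext (gen_mul_comm _ _ _)

lemma commute_hB (j k : ℕ) : Commute (hB j) (hB k) :=
  Subtype.ext (gen_mul_comm _ _ _)

/-- The element `x^+(p)` of `U(B)`, linear in `p`, with `x^+(t ^ k) = x_k^+`. -/
def raiseOp : ℂ[X] →ₗ[ℂ] UB := polyMap xP

/-- The element `x^-(t p)` of `U(B)`, linear in `p`, where `x^-(t ^ k) = x_k^-`; the factor `t`
accounts for the absence of `x_0^-` in `U(B)`. -/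
def lowerOp : ℂ[X] →ₗ[ℂ] UB := polyMap xMsucc

/-- The element `h(p)` of `U(B)`, linear in `p`, with `h(t ^ k) = h_k`. -/
def cartanOp : ℂ[X] →ₗ[ℂ] UB := polyMap hB

@[simp] lemma raiseOp_X_pow (k : ℕ) : raiseOp (X ^ k) = xP k := polyMap_X_pow _ _

@[simp] lemma lowerOp_X_pow (k : ℕ) : lowerOp (X ^ k) = xMsucc k := polyMap_X_pow _ _

@[simp] lemma cartanOp_X_pow (k : ℕ) : cartanOp (X ^ k) = hB k := polyMap_X_pow _ _

lemma raiseOp_mul_lowerOp (p q : ℂ[X]) :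
    raiseOp p * lowerOp q = lowerOp q * raiseOp p + cartanOp (X * (p * q)) := by
  rw [cartanOp, ← polyMap_succ]
  exact polyMap_mul_polyMap xP_mul_xMsucc p q

lemma cartanOp_mul_lowerOp (p q : ℂ[X]) :
    cartanOp p * lowerOp q = lowerOp q * cartanOp p + (-2 : ℂ) • lowerOp (p * q) := by
  rw [← LinearMap.smul_apply, eq_polyMap (T := (-2 : ℂ) • lowerOp) fun k => by
    rw [LinearMap.smul_apply, lowerOp_X_pow]]
  exact polyMap_mul_polyMap hB_mul_xMsucc p q

lemma cartanOp_mul_raiseOp (p q : ℂ[X]) :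
    cartanOp p * raiseOp q = raiseOp q * cartanOp p + (2 : ℂ) • raiseOp (p * q) := by
  rw [← LinearMap.smul_apply, eq_polyMap (T := (2 : ℂ) • raiseOp) fun k => by
    rw [LinearMap.smul_apply, raiseOp_X_pow]]
  exact polyMap_mul_polyMap hB_mul_xP p q

lemma commute_lowerOp (p q : ℂ[X]) : Commute (lowerOp p) (lowerOp q) := by
  have h_comm : ∀ i j, xMsucc i * xMsucc j = xMsucc j * xMsucc i + (fun _ => 0) (i + j) :=
    fun i j => by rw [(commute_xMsucc i j).eq, add_zero]
  have h_mul := polyMap_mul_polyMap (k := fun _ => 0) h_comm p q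
  rwa [polyMap_zero, add_zero] at h_mul

lemma coe_lowerOp (p : ℂ[X]) :
    (lowerOp p : U) = polyMap (fun k : ℕ => xMinus k) (X * p) := by
  rw [← polyMap_succ]
  exact map_polyMap UB.val.toLinearMap xMsucc p

lemma xMinusParam_eq_polyMap (A : Multiset ℂ) :
    xMinusParam A = polyMap (fun k : ℕ => xMinus k) (A.map fun c => X - C c).prod := by
  rw [Multiset.prod_X_sub_X_eq_sum_esymm, map_sum, xMinusParam]
  refine Finset.sum_congr rfl fun k hk => ?_
  have h_term : (-1 : ℂ[X]) ^ k * (C (A.esymm k) * X ^ (A.card - k)) =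
      ((-1 : ℂ) ^ k * A.esymm k) • X ^ (A.card - k) := by
    simp [smul_eq_C_mul, mul_assoc]
  rw [h_term, map_smul, polyMap_X_pow,
    Nat.cast_sub (Nat.lt_succ_iff.mp (Finset.mem_range.mp hk))]

lemma xMinusExt_eq_lowerOp {ι : Type*} [Fintype ι] (a : ι → ℂ) :
    xMinusExt (Finset.univ.val.map a) = lowerOp (∏ i, (X - C (a i))) := by
  apply Subtype.ext
  rw [coe_lowerOp]
  change xMinusParam _ = _
  rw [xMinusParam_eq_polyMap, Multiset.map_cons, Multiset.prod_cons, C_0,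
    sub_zero, Multiset.map_map]
  rfl

end Currents

section Modules

variable {V : Type*} [AddCommGroup V] [Module ℂ V] [Module UB V]

/-- The smallest subspace that contains `K` and is stable under all `x_k^-`. -/
def lowerClosure (K : Submodule ℂ V) : Submodule ℂ V :=
  sInf {T | K ≤ T ∧ ∀ k, ∀ v ∈ T, xMsucc k • v ∈ T}

lemma le_lowerClosure (K : Submodule ℂ V) : K ≤ lowerClosure K :=
  le_sInf fun _ hT => hT.1

lemma lowerClosure_le {K T : Submodule ℂ V} (hKT : K ≤ T)
    (hT : ∀ k, ∀ v ∈ T, xMsucc k • v ∈ T) : lowerClosure K ≤ T :=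
  sInf_le ⟨hKT, hT⟩

lemma xMsucc_smul_mem_lowerClosure {K : Submodule ℂ V} (k : ℕ) {v : V}
    (hv : v ∈ lowerClosure K) : xMsucc k • v ∈ lowerClosure K :=
  Submodule.mem_sInf.mpr fun T hT => hT.2 k v (Submodule.mem_sInf.mp hv T hT)

variable [IsScalarTower ℂ UB V]

variable (V) in
/-- The action of `U(B)` by linear operators. -/
def act : UB →ₐ[ℂ] End ℂ V := Algebra.lsmul ℂ ℂ V

@[simp] lemma act_apply (u : UB) (v : V) : act V u v = u • v := rfl

variable (V) in
/-- The space of singular vectors, those killed by all `x_k^+`. -/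
def singularSpace : Submodule ℂ V := ⨅ k, LinearMap.ker (act V (xP k))

lemma mem_singularSpace {v : V} : v ∈ singularSpace V ↔ ∀ k, xP k • v = 0 := by
  simp [singularSpace]

lemma raiseOp_smul_eq_zero {v : V} (hv : v ∈ singularSpace V) (p : ℂ[X]) :
    raiseOp p • v = 0 := by
  have h_poly := map_polyMap ((act V).toLinearMap.flip v) xP p
  simp only [LinearMap.flip_apply, AlgHom.toLinearMap_apply, act_apply,
    mem_singularSpace.mp hv] at h_poly
  rw [raiseOp, h_poly, polyMap_zero]

lemma hB_smul_mem_singularSpace (j : ℕ) {v : V} (hv : v ∈ singularSpace V) :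
    hB j • v ∈ singularSpace V := by
  rw [mem_singularSpace] at hv ⊢
  intro k
  have h_comm : xP k * hB j = hB j * xP k - (2 : ℂ) • xP (j + k) :=
    eq_sub_of_add_eq (hB_mul_xP j k).symm
  rw [← mul_smul, h_comm, sub_smul, mul_smul, smul_assoc, hv, hv, smul_zero, smul_zero, sub_zero]

section TriangularDecomposition

lemma smul_mem_of_generators {S : Submodule ℂ V} (h_cartan : ∀ v ∈ S, hB 0 • v ∈ S)
    (h_raise : ∀ v ∈ S, xP 0 • v ∈ S) (h_lower : ∀ v ∈ S, xMsucc 0 • v ∈ S) (u : UB) :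
    ∀ v ∈ S, u • v ∈ S := by
  obtain ⟨x, hx⟩ := u
  refine Algebra.adjoin_induction (R := ℂ) (s := {hGen 0, xPlus 0, xMinus 1})
    (p := fun x hx => ∀ v ∈ S, (⟨x, hx⟩ : UB) • v ∈ S) ?_ ?_ ?_ ?_ hx
  · rintro x (rfl | rfl | rfl)
    exacts [h_cartan, h_raise, h_lower]
  · intro c v hv
    have h_mem := S.smul_mem c hv
    rwa [← algebraMap_smul UB c v] at h_mem
  · intro x y hx hy ihx ihy v hv
    have h_mem := S.add_mem (ihx v hv) (ihy v hv)
    rwa [← add_smul] at h_mem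
  · intro x y hx hy ihx ihy v hv
    have h_mem := ihx _ (ihy v hv)
    rwa [← mul_smul] at h_mem

variable {K : Submodule ℂ V}

lemma hB_smul_mem_lowerClosure (hK : ∀ j, ∀ v ∈ K, hB j • v ∈ K) (j : ℕ) {v : V}
    (hv : v ∈ lowerClosure K) : hB j • v ∈ lowerClosure K := by
  have h_le : lowerClosure K ≤ lowerClosure K ⊓ ⨅ j, (lowerClosure K).comap (act V (hB j)) := by
    refine lowerClosure_le (le_inf (le_lowerClosure K) (le_iInf fun j v hv =>
      le_lowerClosure K (hK j v hv))) fun k v hv => ?_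
    simp only [Submodule.mem_inf, Submodule.mem_iInf, Submodule.mem_comap, act_apply] at hv ⊢
    refine ⟨xMsucc_smul_mem_lowerClosure k hv.1, fun j => ?_⟩
    rw [← mul_smul, hB_mul_xMsucc, add_smul, mul_smul, smul_assoc]
    exact Submodule.add_mem _ (xMsucc_smul_mem_lowerClosure k (hv.2 j))
      (Submodule.smul_mem _ _ (xMsucc_smul_mem_lowerClosure _ hv.1))
  exact (Submodule.mem_iInf _).mp (h_le hv).2 j

lemma xP_smul_mem_lowerClosure (hK : ∀ j, ∀ v ∈ K, hB j • v ∈ K) (hKs : K ≤ singularSpace V)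
    (j : ℕ) {v : V} (hv : v ∈ lowerClosure K) : xP j • v ∈ lowerClosure K := by
  have h_le : lowerClosure K ≤ lowerClosure K ⊓ (lowerClosure K).comap (act V (xP j)) := by
    refine lowerClosure_le (le_inf (le_lowerClosure K) fun v hv => ?_) fun k v hv => ?_
    · rw [Submodule.mem_comap, act_apply, mem_singularSpace.mp (hKs hv)]
      exact Submodule.zero_mem _
    · simp only [Submodule.mem_inf, Submodule.mem_comap, act_apply] at hv ⊢
      refine ⟨xMsucc_smul_mem_lowerClosure k hv.1, ?_⟩
      rw [← mul_smul, xP_mul_xMsucc, add_smul, mul_smul]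
      exact Submodule.add_mem _ (xMsucc_smul_mem_lowerClosure k hv.2)
        (hB_smul_mem_lowerClosure hK _ hv.1)
  exact (h_le hv).2

/-- The triangular decomposition `U(B) = U⁻ U⁰ U⁺`, as seen by a space of singular vectors. -/
lemma span_le_of_singular {T : Submodule ℂ V} (hK : ∀ j, ∀ v ∈ K, hB j • v ∈ K)
    (hKs : K ≤ singularSpace V) (hKT : K ≤ T) (hT : ∀ k, ∀ v ∈ T, xMsucc k • v ∈ T) :
    (Submodule.span UB (K : Set V)).restrictScalars ℂ ≤ T := by
  let N : Submodule UB V :=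
    { (lowerClosure K).toAddSubmonoid with
      smul_mem' := smul_mem_of_generators
        (fun _ hv => hB_smul_mem_lowerClosure hK 0 hv)
        (fun _ hv => xP_smul_mem_lowerClosure hK hKs 0 hv)
        (fun _ hv => xMsucc_smul_mem_lowerClosure 0 hv) }
  have h_span : Submodule.span UB (K : Set V) ≤ N := Submodule.span_le.mpr (le_lowerClosure K)
  exact fun v hv => lowerClosure_le hKT hT (h_span hv)

end TriangularDecomposition

section Weights

variable (V) in
/-- The sum of the weight spaces, for `h_0`, of weights `c - 2, c - 4, …`. -/
def weightsBelow (c : ℂ) : Submodule ℂ V :=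
  ⨆ n : ℕ, (act V (hB 0)).eigenspace (c - 2 * (n + 1))

lemma disjoint_eigenspace_weightsBelow (c : ℂ) :
    Disjoint ((act V (hB 0)).eigenspace c) (weightsBelow V c) := by
  refine ((act V (hB 0)).eigenspaces_iSupIndep c).mono_right (iSup_le fun n => ?_)
  refine le_iSup₂_of_le (c - 2 * (n + 1)) ?_ le_rfl
  simpa [sub_eq_self] using Nat.cast_add_one_ne_zero n

lemma lowerOp_smul_mem_eigenspace (p : ℂ[X]) {c : ℂ} {v : V}
    (hv : v ∈ (act V (hB 0)).eigenspace c) :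
    lowerOp p • v ∈ (act V (hB 0)).eigenspace (c - 2) := by
  rw [End.mem_eigenspace_iff, act_apply] at hv ⊢
  have h_comm := cartanOp_mul_lowerOp (X ^ 0) p
  rw [cartanOp_X_pow, pow_zero, one_mul] at h_comm
  rw [← mul_smul, h_comm, add_smul, mul_smul, hv, smul_algebra_smul_comm, smul_assoc,
    ← add_smul, ← sub_eq_add_neg]

lemma lowerOp_smul_mem_weightsBelow_of_mem_eigenspace (p : ℂ[X]) {c : ℂ} {v : V}
    (hv : v ∈ (act V (hB 0)).eigenspace c) : lowerOp p • v ∈ weightsBelow V c :=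
  Submodule.mem_iSup_of_mem 0 (by simpa using lowerOp_smul_mem_eigenspace p hv)

lemma lowerOp_smul_mem_weightsBelow (p : ℂ[X]) {c : ℂ} {v : V} (hv : v ∈ weightsBelow V c) :
    lowerOp p • v ∈ weightsBelow V c := by
  have h_le : weightsBelow V c ≤ (weightsBelow V c).comap (act V (lowerOp p)) := by
    refine iSup_le fun n v hv => Submodule.mem_iSup_of_mem (n + 1) ?_
    have h_weight : c - 2 * ((n : ℂ) + 1) - 2 = c - 2 * ((n + 1 : ℕ) + 1) := by
      push_cast
      ring
    exact h_weight ▸ lowerOp_smul_mem_eigenspace p hv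
  exact h_le hv

lemma hB_smul_mem_weightsBelow (j : ℕ) {c : ℂ} {v : V} (hv : v ∈ weightsBelow V c) :
    hB j • v ∈ weightsBelow V c := by
  have h_le : weightsBelow V c ≤ (weightsBelow V c).comap (act V (hB j)) := by
    refine iSup_le fun n v hv => Submodule.mem_iSup_of_mem n ?_
    rw [End.mem_eigenspace_iff, act_apply] at hv ⊢
    rw [act_apply, ← mul_smul, (commute_hB 0 j).eq, mul_smul, hv, smul_algebra_smul_comm]
  exact h_le hv

end Weights

/-- A singular vector is found among the eigenvectors of `h_0` whose eigenvalue has the largest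
real part, since each `x_k^+` adds `2` to the eigenvalue. -/
lemma exists_singular_ne_zero [FiniteDimensional ℂ V] [Nontrivial V] :
    ∃ w ∈ singularSpace V, w ≠ 0 := by
  obtain ⟨μ, hμ, h_max⟩ := Set.exists_max_image {μ | (act V (hB 0)).HasEigenvalue μ} Complex.re
    (act V (hB 0)).finite_hasEigenvalue (End.exists_eigenvalue _)
  obtain ⟨w, hw⟩ := End.HasEigenvalue.exists_hasEigenvector hμ
  refine ⟨w, mem_singularSpace.mpr fun k => ?_, hw.2⟩
  by_contra h_ne
  have h_shift : hB 0 • xP k • w = (μ + 2) • xP k • w := by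
    have h_weight : hB 0 • w = μ • w := hw.apply_eq_smul
    rw [← mul_smul, hB_mul_xP, zero_add, add_smul, mul_smul, h_weight, smul_algebra_smul_comm,
      smul_assoc, add_smul]
  have h_le := h_max (μ + 2)
    (End.hasEigenvalue_of_hasEigenvector ⟨End.mem_eigenspace_iff.mpr h_shift, h_ne⟩)
  simp at h_le
  linarith

namespace IsHighestWeightVector

variable {d : ℕ → ℂ} {Ψ : V}

lemma mem_singularSpace (hΨ : IsHighestWeightVector d Ψ) : Ψ ∈ singularSpace V :=
  LoopSL2.mem_singularSpace.mpr hΨ.xP_smul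

lemma mem_eigenspace (hΨ : IsHighestWeightVector d Ψ) :
    Ψ ∈ (act V (hB 0)).eigenspace (d 0) :=
  End.mem_eigenspace_iff.mpr (hΨ.hB_smul 0)

lemma cartanOp_smul (hΨ : IsHighestWeightVector d Ψ) (p : ℂ[X]) :
    cartanOp p • Ψ = polyMap d p • Ψ := by
  have h_act := map_polyMap ((act V).toLinearMap.flip Ψ) hB p
  have h_weight := map_polyMap (LinearMap.toSpanSingleton ℂ V Ψ) d p
  simp only [LinearMap.flip_apply, AlgHom.toLinearMap_apply, act_apply, hΨ.hB_smul] at h_act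
  rw [cartanOp, h_act, ← LinearMap.toSpanSingleton_apply, h_weight]
  rfl

lemma mem_of_lower_stable (hΨ : IsHighestWeightVector d Ψ) (hgen : Submodule.span UB {Ψ} = ⊤)
    {T : Submodule ℂ V} (hΨT : Ψ ∈ T) (hT : ∀ k, ∀ v ∈ T, xMsucc k • v ∈ T) (v : V) : v ∈ T := by
  have h_cartan : ∀ j, ∀ v ∈ ℂ ∙ Ψ, hB j • v ∈ ℂ ∙ Ψ := by
    intro j v hv
    obtain ⟨c, rfl⟩ := Submodule.mem_span_singleton.mp hv
    rw [smul_algebra_smul_comm, hΨ.hB_smul]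
    exact Submodule.smul_mem _ _ (Submodule.smul_mem _ _ (Submodule.mem_span_singleton_self Ψ))
  refine span_le_of_singular h_cartan ((Submodule.span_singleton_le_iff_mem _ _).mpr
    hΨ.mem_singularSpace) ((Submodule.span_singleton_le_iff_mem _ _).mpr hΨT) hT ?_
  have h_top : (⊤ : Submodule UB V) ≤ Submodule.span UB (ℂ ∙ Ψ : Submodule ℂ V) := by
    rw [← hgen]
    exact Submodule.span_mono Submodule.subset_span
  exact h_top Submodule.mem_top

lemma apply_eq_smul_of_commute (hΨ : IsHighestWeightVector d Ψ)
    (hgen : Submodule.span UB {Ψ} = ⊤) {T : End ℂ V} {c : ℂ}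
    (hT : ∀ k, Commute T (act V (xMsucc k))) (hc : T Ψ = c • Ψ) (v : V) : T v = c • v := by
  rw [← End.mem_eigenspace_iff] at hc ⊢
  refine hΨ.mem_of_lower_stable hgen hc (fun k v hv => ?_) v
  rw [End.mem_eigenspace_iff] at hv ⊢
  rw [← act_apply, ← End.mul_apply, (hT k).eq, End.mul_apply, hv, map_smul]

lemma exists_smul_add_eq (hΨ : IsHighestWeightVector d Ψ) (hgen : Submodule.span UB {Ψ} = ⊤)
    (v : V) : ∃ c : ℂ, ∃ w ∈ weightsBelow V (d 0), c • Ψ + w = v := by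
  suffices v ∈ (ℂ ∙ Ψ) ⊔ weightsBelow V (d 0) by
    simpa [Submodule.mem_sup, Submodule.mem_span_singleton] using this
  refine hΨ.mem_of_lower_stable hgen
    (Submodule.mem_sup_left (Submodule.mem_span_singleton_self Ψ)) (fun k v hv => ?_) v
  obtain ⟨y, hy, w, hw, rfl⟩ := Submodule.mem_sup.mp hv
  obtain ⟨c, rfl⟩ := Submodule.mem_span_singleton.mp hy
  rw [← lowerOp_X_pow, smul_add, smul_algebra_smul_comm]
  exact Submodule.mem_sup_right (Submodule.add_mem _ (Submodule.smul_mem _ _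
    (lowerOp_smul_mem_weightsBelow_of_mem_eigenspace _ hΨ.mem_eigenspace))
    (lowerOp_smul_mem_weightsBelow _ hw))

lemma mem_span_of_mem_eigenspace (hΨ : IsHighestWeightVector d Ψ)
    (hgen : Submodule.span UB {Ψ} = ⊤) {w : V} (hw : w ∈ (act V (hB 0)).eigenspace (d 0)) :
    w ∈ ℂ ∙ Ψ := by
  obtain ⟨c, y, hy, rfl⟩ := hΨ.exists_smul_add_eq hgen w
  have hy0 : y = 0 := Submodule.disjoint_def.mp (disjoint_eigenspace_weightsBelow (d 0)) y
    ((Submodule.add_mem_iff_right _ (Submodule.smul_mem _ c hΨ.mem_eigenspace)).mp hw) hy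
  rw [hy0, add_zero]
  exact Submodule.smul_mem _ c (Submodule.mem_span_singleton_self Ψ)

lemma singularSpace_le_span [IsSimpleModule UB V] (hΨ : IsHighestWeightVector d Ψ) :
    singularSpace V ≤ ℂ ∙ Ψ := by
  intro v hv
  obtain ⟨c, w, hw, rfl⟩ := hΨ.exists_smul_add_eq
    (IsSimpleModule.span_singleton_eq_top UB hΨ.ne_zero) v
  have hw_sing : w ∈ singularSpace V := (Submodule.add_mem_iff_right _
    (Submodule.smul_mem _ c hΨ.mem_singularSpace)).mp hv
  let K : Submodule ℂ V := singularSpace V ⊓ weightsBelow V (d 0)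
  have h_span : (Submodule.span UB (K : Set V)).restrictScalars ℂ ≤ weightsBelow V (d 0) :=
    span_le_of_singular (fun j v hv =>
        ⟨hB_smul_mem_singularSpace j hv.1, hB_smul_mem_weightsBelow j hv.2⟩)
      inf_le_left inf_le_right fun k v hv => lowerOp_X_pow k ▸ lowerOp_smul_mem_weightsBelow _ hv
  have h_ne_top : Submodule.span UB (K : Set V) ≠ ⊤ := fun h_top =>
    hΨ.ne_zero (Submodule.disjoint_def.mp (disjoint_eigenspace_weightsBelow (d 0)) Ψ
      hΨ.mem_eigenspace (h_span (h_top ▸ Submodule.mem_top)))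
  have h_bot := (eq_bot_or_eq_top (Submodule.span UB (K : Set V))).resolve_right h_ne_top
  have hw0 : w = 0 := Submodule.span_eq_bot.mp h_bot w ⟨hw_sing, hw⟩
  rw [hw0, add_zero]
  exact Submodule.smul_mem _ c (Submodule.mem_span_singleton_self Ψ)

lemma isSimpleModule_of_singularSpace_le [FiniteDimensional ℂ V]
    (hΨ : IsHighestWeightVector d Ψ) (hgen : Submodule.span UB {Ψ} = ⊤)
    (h_sing : singularSpace V ≤ ℂ ∙ Ψ) : IsSimpleModule UB V := by
  have : Nontrivial V := ⟨Ψ, 0, hΨ.ne_zero⟩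
  refine { eq_bot_or_eq_top := fun N => or_iff_not_imp_left.mpr fun hN => ?_ }
  have : Nontrivial N := Submodule.nontrivial_iff_ne_bot.mpr hN
  have : FiniteDimensional ℂ N := FiniteDimensional.finiteDimensional_submodule
    (N.restrictScalars ℂ)
  obtain ⟨w, hw, hw0⟩ := exists_singular_ne_zero (V := N)
  have hw_sing : (w : V) ∈ singularSpace V := LoopSL2.mem_singularSpace.mpr fun k =>
    congrArg Subtype.val (LoopSL2.mem_singularSpace.mp hw k)
  obtain ⟨c, hc⟩ := Submodule.mem_span_singleton.mp (h_sing hw_sing)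
  have hc0 : c ≠ 0 := by
    rintro rfl
    exact hw0 (Subtype.ext (by rw [← hc, zero_smul, Submodule.coe_zero]))
  rw [eq_top_iff, ← hgen, Submodule.span_singleton_le_iff_mem, ← inv_smul_smul₀ hc0 Ψ, hc]
  exact (N.restrictScalars ℂ).smul_mem _ w.2

end IsHighestWeightVector

end Modules

section DrinfeldPolynomial

variable {V : Type*} [AddCommGroup V] [Module ℂ V] [Module UB V] [IsScalarTower ℂ UB V]
  {d : ℕ → ℂ} {Ψ : V}

namespace IsHighestWeightVector

lemma isCurrentAction (hΨ : IsHighestWeightVector d Ψ) :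
    IsCurrentAction (act V (xP 0)) (fun k => act V (xMsucc k)) (fun k => act V (hB (k + 1)))
      (fun k => d (k + 1)) Ψ where
  comm i j := (commute_xMsucc i j).map (act V)
  raise_lower i := by rw [← map_mul, ← map_mul, ← map_add, xP_mul_xMsucc, zero_add]
  cartan_lower i j := by
    rw [← map_mul, ← map_mul, hB_mul_xMsucc, map_add, map_smul, sub_eq_add_neg,
      Nat.add_right_comm, neg_smul, ofNat_smul_eq_nsmul]
  raise_vec := hΨ.xP_smul 0
  cartan_vec i := hΨ.hB_smul (i + 1)

lemma xP_pow_mul_xMsucc_pow_smul (hΨ : IsHighestWeightVector d Ψ) (n : ℕ) :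
    (xP 0 ^ n * xMsucc 0 ^ n) • Ψ =
      (n.factorial * n.factorial * ((-1) ^ n * expCoeff (fun k => d (k + 1)) n) : ℂ) • Ψ := by
  have h_garland := hΨ.isCurrentAction.raise_pow_mul_lower_pow_self
    (derivative_mk_expCoeff fun k => d (k + 1)) (by simp [expCoeff]) n
  rwa [← map_pow, ← map_pow, ← map_mul, act_apply, PowerSeries.coeff_mk] at h_garland

lemma eigenvalue_eq (hΨ : IsHighestWeightVector d Ψ) (n : ℕ) :
    eigenvalue n Ψ = (-1) ^ n * expCoeff (fun k => d (k + 1)) n := by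
  have h_smul := dividedProduct_smul hΨ n
  rw [dividedProduct, smul_mul_smul_comm, smul_assoc, hΨ.xP_pow_mul_xMsucc_pow_smul,
    smul_smul] at h_smul
  have hn : (n.factorial : ℂ) ≠ 0 := Nat.cast_ne_zero.mpr n.factorial_ne_zero
  rw [← smul_left_injective ℂ hΨ.ne_zero h_smul]
  field_simp

lemma expCoeff_eq_zero (hΨ : IsHighestWeightVector d Ψ) {n : ℕ} (hn : xMsucc 0 ^ n • Ψ = 0) :
    expCoeff (fun k => d (k + 1)) n = 0 := by
  have h_smul := hΨ.xP_pow_mul_xMsucc_pow_smul n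
  rw [mul_smul, hn, smul_zero, eq_comm, smul_eq_zero_iff_left hΨ.ne_zero] at h_smul
  simpa [n.factorial_ne_zero] using h_smul

lemma mk_expCoeff_eq (hΨ : IsHighestWeightVector d Ψ) {r : ℕ}
    (hr : xMsucc 0 ^ (r + 1) • Ψ = 0) :
    PowerSeries.mk (expCoeff fun k => d (k + 1)) = (drinfeldPoly r Ψ : PowerSeries ℂ) := by
  have h_term : ∀ k, C (eigenvalue k Ψ) * (-X : ℂ[X]) ^ k =
      C (expCoeff (fun k => d (k + 1)) k) * X ^ k := fun k => by
    rw [hΨ.eigenvalue_eq, C_mul, neg_pow (X : ℂ[X]), mul_mul_mul_comm, mul_assoc]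
    simp [← mul_assoc, ← mul_pow]
  ext n
  rw [PowerSeries.coeff_mk, Polynomial.coeff_coe, drinfeldPoly]
  simp only [h_term, Polynomial.finsetSum_coeff, Polynomial.coeff_C_mul_X_pow,
    Finset.sum_ite_eq, Finset.mem_range]
  split_ifs with hn
  · rfl
  · refine hΨ.expCoeff_eq_zero ?_
    rw [← Nat.sub_add_cancel (not_lt.mp hn), pow_add, mul_smul, hr, smul_zero]

lemma weight_eq (hΨ : IsHighestWeightVector d Ψ) {r : ℕ} (hr : xMsucc 0 ^ (r + 1) • Ψ = 0)
    {ι : Type*} [Fintype ι] {a : ι → ℂ} {m : ι → ℕ}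
    (h_fact : drinfeldPoly r Ψ = ∏ i, (1 - C (a i) * X) ^ m i) (k : ℕ) :
    d (k + 1) = ∑ i, m i * a i ^ (k + 1) := by
  have h_prod : PowerSeries.mk (expCoeff fun k => d (k + 1)) =
      ∏ i, (1 - PowerSeries.C (a i) * PowerSeries.X) ^ m i := by
    rw [hΨ.mk_expCoeff_eq hr, h_fact, ← Polynomial.coeToPowerSeries.ringHom_apply, map_prod]
    simp
  exact eq_sum_pow_of_derivative_eq (d := fun k => d (k + 1))
    (h_prod ▸ derivative_mk_expCoeff _) k

end IsHighestWeightVector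

end DrinfeldPolynomial

section Casimir

attribute [local instance 100] LieRing.ofAssociativeRing

/-- Four times the Casimir element `f e + h ^ 2 / 4 + h / 2` of an `sl₂` triple. -/
def casimir {A : Type*} [Ring A] (h e f : A) : A := 4 • (f * e) + h * h + 2 • h

lemma commute_casimir {R A : Type*} [CommRing R] [Ring A] [Algebra R A] {h e f y : A} {c : R}
    (h_lower : h * f = f * h - 2 • f) (h_comm : Commute f y) (h_raise : e * y = y * e + c • h)
    (h_cartan : h * y = y * h - (2 * c) • f) : Commute (casimir h e f) y := by
  have h_fe : f * e * y = y * (f * e) + c • (f * h) := by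
    rw [mul_assoc, h_raise, mul_add, mul_smul_comm, ← mul_assoc, h_comm.eq, mul_assoc]
  have h_hh : h * h * y = y * (h * h) - (4 * c) • (f * h) + (4 * c) • f := by
    rw [mul_assoc, h_cartan, mul_sub, ← mul_assoc, h_cartan, mul_smul_comm, h_lower, sub_mul,
      smul_mul_assoc, mul_assoc]
    module
  rw [Commute, SemiconjBy, casimir, add_mul, add_mul, smul_mul_assoc, smul_mul_assoc, h_fe, h_hh,
    h_cartan, mul_add, mul_add, mul_smul_comm, mul_smul_comm]
  module

variable {K V : Type*} [Field K] [AddCommGroup V] [Module K V]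

lemma casimir_apply_of_apply_eq_zero {h e f : End K V} {v : V} (he : e v = 0) :
    casimir h e f v = h (h v) + 2 • h v := by
  simp [casimir, he]

/-- The Casimir relation leaves only the weights `μ` and `-(μ + 2)`, which are not both natural
numbers. -/
lemma lie_eq_smul_of_casimir [CharZero K] [FiniteDimensional K V] {L : Type*} [LieRing L]
    [LieAlgebra K L] [LieRingModule L V] [LieModule K L V] {h e f : L} {t : IsSl2Triple h e f}
    {m w : V} {μ : K} (hm : t.HasPrimitiveVectorWith m μ) (he : ⁅e, w⁆ = 0)
    (hw : ⁅h, ⁅h, w⁆⁆ + 2 • ⁅h, w⁆ = (μ * (μ + 2)) • w) : ⁅h, w⁆ = μ • w := by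
  by_contra h_ne
  have h_prim : t.HasPrimitiveVectorWith (⁅h, w⁆ - μ • w) (-(μ + 2)) :=
    { ne_zero := sub_ne_zero.mpr h_ne
      lie_h := by
        rw [lie_sub, lie_smul, eq_sub_of_add_eq hw]
        module
      lie_e := by
        rw [lie_sub, lie_smul, he, smul_zero, sub_zero, leibniz_lie, he, lie_zero, add_zero,
          ← lie_skew, t.lie_h_e_nsmul, neg_lie, nsmul_lie, he, smul_zero, neg_zero] }
  obtain ⟨k, hk⟩ := hm.exists_nat
  obtain ⟨n, hn⟩ := h_prim.exists_nat
  have h_sum : ((n + k + 2 : ℕ) : K) = 0 := by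
    push_cast
    rw [← hk, ← hn]
    ring
  exact absurd h_sum (Nat.cast_ne_zero.mpr (by omega))

end Casimir

section Evaluation

/-- The polynomial `ψ_j` with the value `1 / a_j` at `a_j` and `0` at the other nodes; if no node
vanishes, the `X * ψ_j` are the primitive idempotents of `F[X] / ∏ (X - a_i)`. -/
def nodePoly {F ι : Type*} [Field F] [Fintype ι] [DecidableEq ι] (a : ι → F) (j : ι) : F[X] :=
  C (a j)⁻¹ * Lagrange.basis Finset.univ a j

section NodePoly

variable {F ι : Type*} [Field F] [Fintype ι] [DecidableEq ι] {a : ι → F}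

lemma eval_nodePoly_of_ne {i j : ι} (hij : j ≠ i) : (nodePoly a j).eval (a i) = 0 := by
  rw [nodePoly, eval_mul, Lagrange.eval_basis_of_ne hij (Finset.mem_univ i), mul_zero]

lemma mul_eval_nodePoly (ha : Function.Injective a) {j : ι} (hj : a j ≠ 0) (i : ι) :
    a i * (nodePoly a j).eval (a i) = if j = i then 1 else 0 := by
  split_ifs with hij
  · subst hij
    rw [nodePoly, eval_mul, eval_C, Lagrange.eval_basis_self ha.injOn (Finset.mem_univ j), mul_one,
      mul_inv_cancel₀ hj]
  · rw [eval_nodePoly_of_ne hij, mul_zero]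

lemma eval_X_mul_nodePoly_mul (j : ι) (p : F[X]) (i : ι) :
    (X * (nodePoly a j * p)).eval (a i) =
      ((a j * p.eval (a j)) • nodePoly a j).eval (a i) := by
  rw [eval_mul, eval_mul, eval_X, eval_smul, smul_eq_mul]
  by_cases hij : j = i
  · subst hij
    ring
  · simp [eval_nodePoly_of_ne hij]

lemma eval_sum_X_mul_nodePoly (ha : Function.Injective a) (ha0 : ∀ j, a j ≠ 0) (i : ι) :
    (∑ j, X * nodePoly a j).eval (a i) = 1 := by
  simp [eval_finsetSum, mul_eval_nodePoly ha (ha0 _)]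

end NodePoly

variable {V : Type*} [AddCommGroup V] [Module ℂ V] [Module UB V] [IsScalarTower ℂ UB V]
  {ι : Type*} {a : ι → ℂ}

variable (V) in
/-- The operators `x^-(t p)` on `V` depend only on the values of `p` at the parameters `a`. -/
def LowerFactorsThroughEval (a : ι → ℂ) : Prop :=
  ∀ ⦃p q : ℂ[X]⦄, (∀ i, p.eval (a i) = q.eval (a i)) →
    act V (lowerOp p) = act V (lowerOp q)

namespace LowerFactorsThroughEval

variable {p q ψ : ℂ[X]} {c : ℂ}

lemma cartanOp_congr (H : LowerFactorsThroughEval V a) (h : ∀ i, p.eval (a i) = q.eval (a i)) :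
    act V (cartanOp (X * p)) = act V (cartanOp (X * q)) := by
  have h_bracket : ∀ p, act V (cartanOp (X * p)) =
      act V (raiseOp 1) * act V (lowerOp p) - act V (lowerOp p) * act V (raiseOp 1) := fun p => by
    rw [← map_mul, ← map_mul, raiseOp_mul_lowerOp, map_add, add_sub_cancel_left, one_mul]
  rw [h_bracket, h_bracket, H h]

lemma raiseOp_congr (H : LowerFactorsThroughEval V a) (h : ∀ i, p.eval (a i) = q.eval (a i)) :
    act V (raiseOp (X * p)) = act V (raiseOp (X * q)) := by
  have h_bracket : ∀ p, (2 : ℂ) • act V (raiseOp (X * p)) =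
      act V (cartanOp (X * p)) * act V (raiseOp 1) -
        act V (raiseOp 1) * act V (cartanOp (X * p)) := fun p => by
    rw [← map_mul, ← map_mul, cartanOp_mul_raiseOp, map_add, add_sub_cancel_left, mul_one, map_smul]
  refine smul_right_injective _ (two_ne_zero' ℂ) ?_
  simp only [h_bracket, H.cartanOp_congr h]

lemma raiseOp_mul_lowerOp (H : LowerFactorsThroughEval V a)
    (hψ : ∀ i, (X * (ψ * p)).eval (a i) = (c • ψ).eval (a i)) :
    act V (raiseOp (X * ψ)) * act V (lowerOp p) =
      act V (lowerOp p) * act V (raiseOp (X * ψ)) + c • act V (cartanOp (X * ψ)) := by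
  rw [← map_mul, LoopSL2.raiseOp_mul_lowerOp, map_add, map_mul, mul_assoc X ψ p,
    H.cartanOp_congr hψ, mul_smul_comm, map_smul, map_smul]

lemma cartanOp_mul_lowerOp (H : LowerFactorsThroughEval V a)
    (hψ : ∀ i, (X * (ψ * p)).eval (a i) = (c • ψ).eval (a i)) :
    act V (cartanOp (X * ψ)) * act V (lowerOp p) =
      act V (lowerOp p) * act V (cartanOp (X * ψ)) - (2 * c) • act V (lowerOp ψ) := by
  rw [← map_mul, LoopSL2.cartanOp_mul_lowerOp, map_add, map_mul, map_smul, mul_assoc X ψ p, H hψ,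
    map_smul, map_smul]
  module

lemma cartanOp_mul_raiseOp (H : LowerFactorsThroughEval V a)
    (hψ : ∀ i, (X * (ψ * ψ)).eval (a i) = ψ.eval (a i)) :
    act V (cartanOp (X * ψ)) * act V (raiseOp (X * ψ)) =
      act V (raiseOp (X * ψ)) * act V (cartanOp (X * ψ)) + 2 • act V (raiseOp (X * ψ)) := by
  have h_mul : X * ψ * (X * ψ) = X * (X * (ψ * ψ)) := by ring
  rw [← map_mul, LoopSL2.cartanOp_mul_raiseOp, map_add, map_mul, map_smul, h_mul,
    H.raiseOp_congr hψ, ofNat_smul_eq_nsmul]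

attribute [local instance 100] LieRing.ofAssociativeRing

lemma isSl2Triple (H : LowerFactorsThroughEval V a)
    (hψ : ∀ i, (X * (ψ * ψ)).eval (a i) = ψ.eval (a i)) (h_ne : act V (cartanOp (X * ψ)) ≠ 0) :
    IsSl2Triple (act V (cartanOp (X * ψ))) (act V (raiseOp (X * ψ))) (act V (lowerOp ψ)) := by
  have hψ' : ∀ i, (X * (ψ * ψ)).eval (a i) = ((1 : ℂ) • ψ).eval (a i) := by simpa using hψ
  refine ⟨h_ne, ?_, ?_, ?_⟩ <;> rw [LieRing.of_associative_ring_bracket]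
  · rw [H.raiseOp_mul_lowerOp hψ', add_sub_cancel_left, one_smul]
  · rw [H.cartanOp_mul_raiseOp hψ, add_sub_cancel_left]
  · rw [H.cartanOp_mul_lowerOp hψ', sub_sub_cancel_left, mul_one, ofNat_smul_eq_nsmul]

lemma commute_casimir (H : LowerFactorsThroughEval V a)
    (hψ : ∀ i, (X * (ψ * ψ)).eval (a i) = ψ.eval (a i))
    (hp : ∀ i, (X * (ψ * p)).eval (a i) = (c • ψ).eval (a i)) :
    Commute (casimir (act V (cartanOp (X * ψ))) (act V (raiseOp (X * ψ))) (act V (lowerOp ψ)))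
      (act V (lowerOp p)) := by
  refine LoopSL2.commute_casimir ?_ ((commute_lowerOp ψ p).map (act V))
    (H.raiseOp_mul_lowerOp hp) (H.cartanOp_mul_lowerOp hp)
  rw [H.cartanOp_mul_lowerOp (c := 1) (by simpa using hψ), mul_one, ofNat_smul_eq_nsmul]

end LowerFactorsThroughEval

namespace IsHighestWeightVector

variable {d : ℕ → ℂ} {Ψ : V}

theorem lowerOp_prod_smul_eq_zero [IsSimpleModule UB V] [Fintype ι]
    (hΨ : IsHighestWeightVector d Ψ) {m : ι → ℕ}
    (hd : ∀ k, d (k + 1) = ∑ i, m i * a i ^ (k + 1)) :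
    lowerOp (∏ i, (X - C (a i))) • Ψ = 0 := by
  set q : ℂ[X] := ∏ i, (X - C (a i)) with hq
  have hq_eval : ∀ i, q.eval (a i) = 0 := fun i => by
    rw [hq, eval_prod, Finset.prod_eq_zero (Finset.mem_univ i) (by simp)]
  have h_sing : lowerOp q • Ψ ∈ singularSpace V := LoopSL2.mem_singularSpace.mpr fun k => by
    rw [← raiseOp_X_pow, ← mul_smul, raiseOp_mul_lowerOp, add_smul, mul_smul, raiseOp_X_pow,
      hΨ.xP_smul, smul_zero, zero_add, hΨ.cartanOp_smul, polyMap_X_mul_eq_sum_eval hd]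
    simp [hq_eval]
  obtain ⟨c, hc⟩ := Submodule.mem_span_singleton.mp (hΨ.singularSpace_le_span h_sing)
  exact Submodule.disjoint_def.mp (disjoint_eigenspace_weightsBelow (d 0)) _
    (hc ▸ Submodule.smul_mem _ c hΨ.mem_eigenspace)
    (lowerOp_smul_mem_weightsBelow_of_mem_eigenspace q hΨ.mem_eigenspace)

lemma lowerFactorsThroughEval [Fintype ι] (hΨ : IsHighestWeightVector d Ψ)
    (hgen : Submodule.span UB {Ψ} = ⊤) (ha : Function.Injective a)
    (hq : lowerOp (∏ i, (X - C (a i))) • Ψ = 0) : LowerFactorsThroughEval V a := by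
  intro p p' hp
  obtain ⟨b, hb⟩ := prod_X_sub_C_dvd ha (p := p - p') (by simpa [sub_eq_zero] using hp)
  have h_cartan := congr($(cartanOp_mul_lowerOp b (∏ i, (X - C (a i)))) • Ψ)
  rw [add_smul, mul_smul, mul_smul, hΨ.cartanOp_smul, hq, smul_zero, smul_algebra_smul_comm, hq,
    smul_zero, zero_add, smul_assoc, mul_comm b, ← hb, eq_comm,
    smul_eq_zero_iff_right (by norm_num)] at h_cartan
  rw [← sub_eq_zero, ← map_sub, ← map_sub]
  ext v
  have h_zero := hΨ.apply_eq_smul_of_commute hgen (T := act V (lowerOp (p - p'))) (c := 0)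
    (fun k => lowerOp_X_pow k ▸ (commute_lowerOp _ _).map (act V))
    (by rw [act_apply, h_cartan, zero_smul]) v
  rw [h_zero, zero_smul, LinearMap.zero_apply]

attribute [local instance 100] LieRing.ofAssociativeRing

lemma cartanOp_smul_of_mem_singularSpace [FiniteDimensional ℂ V] (hΨ : IsHighestWeightVector d Ψ)
    (hgen : Submodule.span UB {Ψ} = ⊤) (H : LowerFactorsThroughEval V a) {ψ : ℂ[X]}
    (hψ : ∀ i, (X * (ψ * ψ)).eval (a i) = ψ.eval (a i))
    (hψ_pow : ∀ k, ∃ c : ℂ, ∀ i, (X * (ψ * X ^ k)).eval (a i) = (c • ψ).eval (a i)) {w : V}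
    (hw : w ∈ singularSpace V) : cartanOp (X * ψ) • w = polyMap d (X * ψ) • w := by
  set μ := polyMap d (X * ψ)
  have h_weight : act V (cartanOp (X * ψ)) Ψ = μ • Ψ := hΨ.cartanOp_smul _
  by_cases h_ne : act V (cartanOp (X * ψ)) = 0
  · have hμ : μ = 0 := (smul_eq_zero_iff_left hΨ.ne_zero).mp
      (h_weight ▸ LinearMap.congr_fun h_ne Ψ)
    rw [hμ, zero_smul]
    exact LinearMap.congr_fun h_ne w
  have h_casimir : casimir (act V (cartanOp (X * ψ))) (act V (raiseOp (X * ψ)))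
      (act V (lowerOp ψ)) w = (μ * (μ + 2)) • w := by
    refine hΨ.apply_eq_smul_of_commute hgen (fun k => ?_) ?_ w
    · obtain ⟨c, hc⟩ := hψ_pow k
      exact lowerOp_X_pow k ▸ H.commute_casimir hψ hc
    · rw [casimir_apply_of_apply_eq_zero (raiseOp_smul_eq_zero hΨ.mem_singularSpace _),
        h_weight, map_smul, h_weight]
      module
  rw [casimir_apply_of_apply_eq_zero (raiseOp_smul_eq_zero hw _)] at h_casimir
  have h_prim : (H.isSl2Triple hψ h_ne).HasPrimitiveVectorWith Ψ μ :=
    ⟨hΨ.ne_zero, h_weight, raiseOp_smul_eq_zero hΨ.mem_singularSpace _⟩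
  exact lie_eq_smul_of_casimir h_prim (raiseOp_smul_eq_zero hw _) h_casimir

lemma cartanOp_smul_of_eval_eq_zero (hΨ : IsHighestWeightVector d Ψ)
    (hgen : Submodule.span UB {Ψ} = ⊤) (H : LowerFactorsThroughEval V a) {p : ℂ[X]}
    (hp : ∀ i, p.eval (a i) = 0) (v : V) : cartanOp p • v = polyMap d p • v := by
  refine hΨ.apply_eq_smul_of_commute hgen (T := act V (cartanOp p)) (fun k => ?_)
    (hΨ.cartanOp_smul p) v
  have h_zero : act V (lowerOp (p * X ^ k)) = 0 := by
    rw [H (q := 0) fun i => by simp [hp], map_zero, map_zero]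
  rw [Commute, SemiconjBy, ← lowerOp_X_pow, ← map_mul, cartanOp_mul_lowerOp, map_add, map_smul,
    h_zero, smul_zero, add_zero, map_mul]

lemma hB_zero_smul_of_mem_singularSpace [FiniteDimensional ℂ V] [Finite ι]
    (hΨ : IsHighestWeightVector d Ψ) (hgen : Submodule.span UB {Ψ} = ⊤)
    (H : LowerFactorsThroughEval V a) (ha : Function.Injective a) (ha0 : ∀ j, a j ≠ 0) {w : V}
    (hw : w ∈ singularSpace V) : hB 0 • w = d 0 • w := by
  classical
  have := Fintype.ofFinite ι
  have h_node : ∀ j, cartanOp (X * nodePoly a j) • w = polyMap d (X * nodePoly a j) • w :=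
    fun j => hΨ.cartanOp_smul_of_mem_singularSpace hgen H
      (fun i => by
        rw [eval_X_mul_nodePoly_mul, mul_eval_nodePoly ha (ha0 j), if_pos rfl, one_smul])
      (fun k => ⟨_, eval_X_mul_nodePoly_mul j (X ^ k)⟩) hw
  have h_rest := hΨ.cartanOp_smul_of_eval_eq_zero hgen H (p := 1 - ∑ j, X * nodePoly a j)
    (fun i => by rw [eval_sub, eval_sum_X_mul_nodePoly ha ha0, eval_one, sub_self]) w
  have h_one : cartanOp 1 • w = polyMap d (1 : ℂ[X]) • w := by
    rw [← sub_add_cancel 1 (∑ j, X * nodePoly a j), map_add, map_add, add_smul, add_smul, h_rest,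
      map_sum, map_sum, Finset.sum_smul, Finset.sum_smul]
    simp only [h_node]
  simpa only [← pow_zero (X : ℂ[X]), cartanOp_X_pow, polyMap_X_pow] using h_one

theorem isSimpleModule [FiniteDimensional ℂ V] [Fintype ι] (hΨ : IsHighestWeightVector d Ψ)
    (hgen : Submodule.span UB {Ψ} = ⊤) (ha : Function.Injective a) (ha0 : ∀ j, a j ≠ 0)
    (hq : lowerOp (∏ i, (X - C (a i))) • Ψ = 0) : IsSimpleModule UB V := by
  have H := hΨ.lowerFactorsThroughEval hgen ha hq
  exact hΨ.isSimpleModule_of_singularSpace_le hgen fun w hw =>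
    hΨ.mem_span_of_mem_eigenspace hgen (End.mem_eigenspace_iff.mpr
      (hΨ.hB_zero_smul_of_mem_singularSpace hgen H ha ha0 hw))

end IsHighestWeightVector

end Evaluation

end LoopSL2

end

theorem mainTheorem2 {V : Type*} [AddCommGroup V] [Module ℂ V] [Module LoopSL2.UB V]
    [IsScalarTower ℂ LoopSL2.UB V] [FiniteDimensional ℂ V]
    (d : ℕ → ℂ) (Ψ : V) (hΨ : LoopSL2.IsHighestWeightVector d Ψ)
    (hgen : Submodule.span LoopSL2.UB {Ψ} = ⊤)
    (r : ℕ) (hr : LoopSL2.IsNilpotentOfDegree r Ψ)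
    (s : ℕ) (a : Fin s → ℂ) (m : Fin s → ℕ)
    (ham : LoopSL2.IsEvaluationParameters r Ψ a m)
    (ha : ∀ j, a j ≠ 0) :
    IsSimpleModule LoopSL2.UB V ↔
      LoopSL2.xMinusExt (Finset.univ.val.map a) • Ψ = 0 := by
  rw [LoopSL2.xMinusExt_eq_lowerOp]
  exact ⟨fun _ => hΨ.lowerOp_prod_smul_eq_zero (hΨ.weight_eq hr.1 ham.factorization),
    fun hq => hΨ.isSimpleModule hgen ham.distinct ha hq⟩
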